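/- Let $d\ge 2$. For $u\in\mathbb Z^d$ write $y(u)=u_2$ for its second coordinate. A self-avoiding walk of length $n\in\mathbb N=\{0,1,2,\dots\}$ is an injective map $\gamma:\{0,\dots,n\}\to\mathbb Z^d$ such that $\gamma_k$ and $\gamma_{k+1}$ are nearest neighbours in $\mathbb Z^d$ for each $0\le k<n$. Such a walk is a bridge if $y(\gamma_0)<y(\gamma_k)$ for all $1\le k\le n$ and $y(\gamma_k)\le y(\gamma_n)$ for all $0\le k\le n$. Let $\mathrm{SAB}_n$ be the (finite, non-empty) set of bridges of length $n$ with $\gamma_0=0$, and let $\mathsf P_{\mathrm{SAB}_n}$ be the uniform probability measure on it. The set $\mathsf R_\gamma$ of renewal points of $\gamma\in\mathrm{SAB}_n$ is the set of points $\gamma_i$, $0\le i\le n$, such that $\gamma[0,i]=(\gamma_0,\dots,\gamma_i)$ and $\gamma[i,n]=(\gamma_i,\dots,\gamma_n)$ are both bridges (of lengths $i$ and $n-i$; a one-point walk is a bridge). Put $\log 0=-\infty$. Theorem. Suppose that the ballistic assumption holds: for some $v>0$, $$\limsup_{n\to\infty}\, n^{-1}\log \mathsf P_{\mathrm{SAB}_n}\big(y(\gamma_n)\ge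 vn\big)=0 .$$ Then there exists $\delta>0$ such that $$\limsup_{n\to\infty}\, n^{-1}\log \mathsf P_{\mathrm{SAB}_n}\big(|\mathsf R_\gamma|\ge \delta n\big)=0 .$$ -/

import Mathlib

open Filter MeasureTheory ProbabilityTheory

namespace SAW

/-- The vertices of the integer lattice `ℤ^d`. -/
abbrev Lattice (d : ℕ) : Type := Fin d → ℤ

/-- The coordinate `y(u) = u₂` of a point of `ℤ^d`, `d ≥ 2` (coordinates are numbered from `0`). -/
def yCoord {d : ℕ} (hd : 2 ≤ d) (u : Lattice d) : ℤ := u ⟨1, hd⟩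

/-- `u` and `w` are joined by a nearest-neighbour bond of `ℤ^d`. -/
def Adjacent {d : ℕ} (u w : Lattice d) : Prop := ∑ i, |u i - w i| = 1

/-- `γ : {0, …, n} → ℤ^d` is a walk of length `n`. -/
def IsWalk {d n : ℕ} (γ : Fin (n + 1) → Lattice d) : Prop :=
  ∀ k : Fin n, Adjacent (γ k.castSucc) (γ k.succ)

/-- A self-avoiding walk is an injective walk. -/
def IsSelfAvoiding {d n : ℕ} (γ : Fin (n + 1) → Lattice d) : Prop :=
  IsWalk γ ∧ Function.Injective γ

/-- A (self-avoiding) bridge: a self-avoiding walk whose first element attains uniquely the minimal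
`y`-coordinate, and whose final element attains, not necessarily uniquely, the maximal one. -/
structure IsBridge {d : ℕ} (hd : 2 ≤ d) {n : ℕ} (γ : Fin (n + 1) → Lattice d) : Prop where
  selfAvoiding : IsSelfAvoiding γ
  first_lt : ∀ k, k ≠ 0 → yCoord hd (γ 0) < yCoord hd (γ k)
  le_last : ∀ k, yCoord hd (γ k) ≤ yCoord hd (γ (Fin.last n))

/-- The set of bridges of length `n` that start at the origin. -/
def SAB {d : ℕ} (hd : 2 ≤ d) (n : ℕ) : Set (Fin (n + 1) → Lattice d) :=
  {γ | γ 0 = 0 ∧ IsBridge hd γ}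

/-- The portion `γ[i, j]` of a walk, reparametrised by `{0, …, j - i}`. -/
def subwalk {d n : ℕ} (γ : Fin (n + 1) → Lattice d) (i j : ℕ) (hij : i ≤ j) (hj : j ≤ n) :
    Fin (j - i + 1) → Lattice d :=
  fun k => γ ⟨i + k, by omega⟩

/-- The set of renewal points of `γ`: the points `γ i`, `0 ≤ i ≤ n`, such that `γ[0, i]` and
`γ[i, n]` are both bridges. -/
def renewalPoints {d : ℕ} (hd : 2 ≤ d) {n : ℕ} (γ : Fin (n + 1) → Lattice d) : Set (Lattice d) :=
  {u | ∃ (i : ℕ) (hi : i ≤ n), γ ⟨i, by omega⟩ = u ∧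
    IsBridge hd (subwalk γ 0 i (Nat.zero_le i) hi) ∧ IsBridge hd (subwalk γ i n hi le_rfl)}

/-- The uniform law on the set of bridges of length `n` that start at the origin. -/
noncomputable def bridgeLaw {d : ℕ} (hd : 2 ≤ d) (n : ℕ) : Measure (Fin (n + 1) → Lattice d) :=
  uniformOn (SAB hd n)

theorem SAB_finite {d : ℕ} (hd : 2 ≤ d) (n : ℕ) : (SAB hd n).Finite := by
  refine (Set.finite_Icc (fun _ _ => -(n : ℤ) : Fin (n + 1) → Lattice d)
    (fun _ _ => (n : ℤ))).subset ?_
  rintro γ ⟨h0, hb⟩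
  have key : ∀ k : ℕ, ∀ hk : k < n + 1, ∀ i, |γ ⟨k, hk⟩ i| ≤ (k : ℤ) := by
    intro k
    induction k with
    | zero =>
      intro hk i
      have : γ ⟨0, hk⟩ = 0 := h0
      rw [this]; simp
    | succ k ih =>
      intro hk i
      have h1 := ih (by omega) i
      have h2 : ∑ i, |γ ⟨k, by omega⟩ i - γ ⟨k + 1, hk⟩ i| = 1 :=
        hb.selfAvoiding.1 ⟨k, by omega⟩
      have h3 := Finset.single_le_sum
        (f := fun i => |γ ⟨k, by omega⟩ i - γ ⟨k + 1, hk⟩ i|)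
        (fun j _ => abs_nonneg _) (Finset.mem_univ i)
      rw [h2] at h3
      push_cast
      rw [abs_le] at *
      constructor <;> linarith [h3.1, h3.2, h1.1, h1.2]
  refine ⟨fun k i => ?_, fun k i => ?_⟩
  · have := (abs_le.1 (key k.1 k.2 i)).1
    have := k.2
    show -(n : ℤ) ≤ γ k i
    simp only [Fin.eta] at *
    omega
  · have := (abs_le.1 (key k.1 k.2 i)).2
    have := k.2
    show γ k i ≤ (n : ℤ)
    simp only [Fin.eta] at *
    omega

theorem SAB_nonempty {d : ℕ} (hd : 2 ≤ d) (n : ℕ) : (SAB hd n).Nonempty := by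
  refine ⟨fun k => Pi.single ⟨1, hd⟩ (k : ℤ), by ext i; simp [Pi.single_apply], ⟨?_, ?_⟩, ?_, ?_⟩
  · intro k
    unfold Adjacent
    rw [Finset.sum_eq_single (⟨1, hd⟩ : Fin d)]
    · simp
    · intro b _ hb
      simp [hb]
    · simp
  · intro a b h
    have := Pi.single_injective (M := fun _ : Fin d => ℤ) ⟨1, hd⟩ h
    exact Fin.ext (by exact_mod_cast this)
  · intro k hk
    simp only [yCoord, Pi.single_eq_same]
    have := Fin.pos_of_ne_zero hk
    exact_mod_cast this
  · intro k
    simp only [yCoord, Pi.single_eq_same]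
    exact_mod_cast Fin.le_last k

/-- The uniform law on bridges is well defined. -/
instance {d : ℕ} (hd : 2 ≤ d) (n : ℕ) : IsProbabilityMeasure (bridgeLaw hd n) :=
  isProbabilityMeasure_uniformOn (SAB_finite hd n) (SAB_nonempty hd n)

end SAW

open SAW

/-! Suppose that, for every δ > 0, having δn renewals is exponentially unlikely. Then reaching
height vn is exponentially unlikely for every v > 0, against the ballistic assumption.

Every level from the initial height up to, but excluding, the final one is the height of a renewal
or is crossed by a zigzag, a stretch from a running maximum down to a future minimum
(`exists_renewal_or_zigzag`). Zigzags are pairwise disjoint. Reflecting any set S of them yields a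
bridge, taller by twice their total height, in which both ends of each stretch have become renewals.
The original bridge and S can be recovered from the new bridge once the starts and heights of the
stretches are marked, and these marks sit on renewals. Summing over all S, with weight t per unit of
height and f(r) per zigzag of height r, gives `sum_zigzags_le_sum_renewals`.

Two choices of weights are used. With t = 1 and f constant on r ≤ R, many short zigzags would force
many renewals (`isRare_shortHeight`). With t > 1 and f a geometric tail, long zigzags of large total
height would produce bridges taller than 3vn/2, while summability makes the marks cheap
(`exists_isRare_longHeight`). Hence height vn is rare as soon as height 3vn/2 is. Heights above n
are impossible, so finitely many divisions by 3/2 reach any v > 0. -/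

namespace SAW

/-- The part of the height profile `Y` between `i` and `j` runs from a running maximum down to a
future minimum. -/
structure IsZigzag {n : ℕ} (Y : Fin (n + 1) → ℤ) (i j : Fin (n + 1)) : Prop where
  lt : i < j
  le_top : ∀ k, k ≤ i → Y k ≤ Y i
  lt_top : ∀ k, i < k → k ≤ j → Y k < Y i
  bot_le : ∀ k, i ≤ k → k ≤ j → Y j ≤ Y k
  bot_lt : ∀ k, j < k → Y j < Y k

/-- `i` is a renewal index of the height profile `Y`. -/
structure IsRenewal {n : ℕ} (Y : Fin (n + 1) → ℤ) (i : Fin (n + 1)) : Prop where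
  le : ∀ k, k ≤ i → Y k ≤ Y i
  lt : ∀ k, i < k → Y i < Y k

/-! ### Zigzags of a height profile and their reflection. -/

section Zigzag

variable {n : ℕ} {Y : Fin (n + 1) → ℤ}

theorem IsRenewal.eq_of_height_eq {i j : Fin (n + 1)} (hi : IsRenewal Y i) (hj : IsRenewal Y j)
    (h : Y i = Y j) : i = j := by
  rcases lt_trichotomy i j with hij | hij | hij
  · have := hi.lt j hij; omega
  · exact hij
  · have := hj.lt i hij; omega

/-- A start inside an earlier zigzag would lie strictly below that zigzag's top, so it could not be
a running maximum. -/
theorem IsZigzag.snd_lt_fst {i j i' j' : Fin (n + 1)} (h : IsZigzag Y i j)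
    (h' : IsZigzag Y i' j') (hi : i < i') : j < i' := by
  by_contra hc
  have h1 := h.lt_top i' hi (not_lt.1 hc)
  have h2 := h'.le_top i hi.le
  omega

theorem IsZigzag.snd_eq {i j j' : Fin (n + 1)} (h : IsZigzag Y i j)
    (h' : IsZigzag Y i j') : j = j' := by
  rcases lt_trichotomy j j' with hj | hj | hj
  · have h1 := h.bot_lt j' hj
    have h2 := h'.bot_le j h.lt.le hj.le
    omega
  · exact hj
  · have h1 := h'.bot_lt j hj
    have h2 := h.bot_le j' h'.lt.le hj.le
    omega

theorem IsZigzag.disjoint {z w : Fin (n + 1) × Fin (n + 1)} (hz : IsZigzag Y z.1 z.2)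
    (hw : IsZigzag Y w.1 w.2) (hne : z ≠ w) : z.2 < w.1 ∨ w.2 < z.1 := by
  rcases lt_trichotomy z.1 w.1 with h | h | h
  · exact Or.inl (hz.snd_lt_fst hw h)
  · refine absurd (Prod.ext h ?_) hne
    rw [← h] at hw
    exact hz.snd_eq hw
  · exact Or.inr (hw.snd_lt_fst hz h)

/-- Every level between the first and the last height is a renewal level or is crossed by a
zigzag. -/
theorem exists_renewal_or_zigzag {h : ℤ} (h0 : Y 0 ≤ h) (hn : h < Y (Fin.last n))
    (hstep : ∀ k : Fin n, Y k.succ ≤ Y k.castSucc + 1) :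
    (∃ i, IsRenewal Y i ∧ Y i = h) ∨ ∃ i j, IsZigzag Y i j ∧ Y j ≤ h ∧ h < Y i := by
  classical
  -- `t` is the last time at height at most `h`. Upward steps have size at most one, so `t` is
  -- exactly at height `h`.
  obtain ⟨t, ht, htmax⟩ := (Finset.univ.filter (fun k => Y k ≤ h)).exists_max_image id
    ⟨0, by simpa using h0⟩
  simp only [Finset.mem_filter, Finset.mem_univ, true_and, id] at ht htmax
  have hafter : ∀ k, t < k → h < Y k := fun k hk => by
    by_contra hc
    exact absurd (htmax k (not_lt.1 hc)) (not_le.2 hk)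
  have htn : t ≠ Fin.last n := by rintro rfl; omega
  have hYt : Y t = h := by
    obtain ⟨s, rfl⟩ := Fin.exists_castSucc_eq.2 htn
    have h1 := hstep s
    have h2 := hafter s.succ (Fin.castSucc_lt_succ)
    omega
  by_cases hr : ∀ k, k ≤ t → Y k ≤ Y t
  · exact Or.inl ⟨t, ⟨hr, fun k hk => hYt ▸ hafter k hk⟩, hYt⟩
  right
  push Not at hr
  obtain ⟨k₀, hk₀, hk₀t⟩ := hr
  -- When `t` is not a running maximum, take for `i` the last maximum on `[0, t]` and for `j` the
  -- last minimum of the whole future of `i`. Choosing the last ones gives the strict inequalities,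
  -- and `j ≤ t` because heights exceed `h` after `t`.
  obtain ⟨m, hm, hmmax⟩ := (Finset.Iic t).exists_max_image Y ⟨t, by simp⟩
  simp only [Finset.mem_Iic] at hm hmmax
  obtain ⟨i, hi, himax⟩ := ((Finset.Iic t).filter (fun k => Y k = Y m)).exists_max_image id
    ⟨m, by simpa using hm⟩
  simp only [Finset.mem_filter, Finset.mem_Iic, id] at hi himax
  obtain ⟨m', hm', hmmin⟩ := (Finset.Ici i).exists_min_image Y ⟨i, by simp⟩
  simp only [Finset.mem_Ici] at hm' hmmin
  obtain ⟨j, hj, hjmax⟩ := ((Finset.Ici i).filter (fun k => Y k = Y m')).exists_max_image id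
    ⟨m', by simpa using hm'⟩
  simp only [Finset.mem_filter, Finset.mem_Ici, id] at hj hjmax
  have hjt : Y j ≤ Y t := by rw [hj.2]; exact hmmin t hi.1
  have hit : Y t < Y i := by rw [hi.2]; exact hk₀t.trans_le (hmmax k₀ hk₀)
  have hjlet : j ≤ t := by
    by_contra hc
    have := hafter j (not_le.1 hc)
    omega
  refine ⟨i, j, ⟨lt_of_le_of_ne hj.1 ?_, ?_, ?_, ?_, ?_⟩, by omega, by omega⟩
  · rintro rfl; omega
  · intro k hk
    rw [hi.2]; exact hmmax k (hk.trans hi.1)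
  · intro k hk hkj
    have h1 := hmmax k (hkj.trans hjlet)
    rcases h1.lt_or_eq with h2 | h2
    · rw [hi.2]; exact h2
    · exact absurd (himax k ⟨hkj.trans hjlet, h2⟩) (not_le.2 hk)
  · intro k hk _
    rw [hj.2]; exact hmmin k hk
  · intro k hk
    have hik := hj.1.trans hk.le
    rcases (hmmin k hik).lt_or_eq with h2 | h2
    · rw [hj.2]; exact h2
    · exact absurd (hjmax k ⟨hik, h2.symm⟩) (not_le.2 hk)

/-- The drop accumulated along `[i, j]` up to time `k`. -/
def drop (Y : Fin (n + 1) → ℤ) (z : Fin (n + 1) × Fin (n + 1)) (k : Fin (n + 1)) : ℤ :=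
  Y (min z.1 k) - Y (min z.2 k)

/-- The height profile obtained by reflecting each of the stretches in `S`. -/
def unfold (Y : Fin (n + 1) → ℤ) (S : Finset (Fin (n + 1) × Fin (n + 1))) (k : Fin (n + 1)) : ℤ :=
  Y k + 2 * ∑ z ∈ S, drop Y z k

section
variable {z : Fin (n + 1) × Fin (n + 1)} {k : Fin (n + 1)}

theorem IsZigzag.drop_of_le (hz : IsZigzag Y z.1 z.2) (hk : k ≤ z.1) : drop Y z k = 0 := by
  simp [drop, min_eq_right hk, min_eq_right (hk.trans hz.lt.le)]

theorem IsZigzag.drop_of_ge (hz : IsZigzag Y z.1 z.2) (hk : z.2 ≤ k) :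
    drop Y z k = Y z.1 - Y z.2 := by
  simp [drop, min_eq_left hk, min_eq_left (hz.lt.le.trans hk)]

/-- Adding twice this drop to `Y k` gives `2 * Y z.1 - Y k`, the reflection in the level of the top;
beyond the stretch the drop stays constant, which is a vertical shift. -/
theorem drop_of_mem (h1 : z.1 ≤ k) (h2 : k ≤ z.2) : drop Y z k = Y z.1 - Y k := by
  simp [drop, min_eq_left h1, min_eq_right h2]

theorem IsZigzag.height_pos (hz : IsZigzag Y z.1 z.2) : Y z.2 < Y z.1 :=
  hz.lt_top _ hz.lt le_rfl

theorem IsZigzag.drop_bounds (hz : IsZigzag Y z.1 z.2) (k : Fin (n + 1)) :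
    0 ≤ drop Y z k ∧ drop Y z k ≤ Y z.1 - Y z.2 := by
  have hp := hz.height_pos
  rcases le_total k z.1 with h | h
  · rw [hz.drop_of_le h]; omega
  rcases le_total z.2 k with h' | h'
  · rw [hz.drop_of_ge h']; omega
  rw [drop_of_mem h h']
  have h3 := hz.bot_le k h h'
  rcases h.lt_or_eq with h2 | h2
  · have := hz.lt_top k h2 h'; omega
  · rw [← h2] at *; omega

end

variable {S : Finset (Fin (n + 1) × Fin (n + 1))}

theorem unfold_zero (hS : ∀ z ∈ S, IsZigzag Y z.1 z.2) : unfold Y S 0 = Y 0 := by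
  simp [unfold, Finset.sum_eq_zero fun z hz => (hS z hz).drop_of_le (Fin.zero_le _)]

theorem unfold_last (hS : ∀ z ∈ S, IsZigzag Y z.1 z.2) :
    unfold Y S (Fin.last n) = Y (Fin.last n) + 2 * ∑ z ∈ S, (Y z.1 - Y z.2) := by
  rw [unfold, Finset.sum_congr rfl fun z hz => (hS z hz).drop_of_ge (Fin.le_last _)]

theorem le_unfold (hS : ∀ z ∈ S, IsZigzag Y z.1 z.2) (k : Fin (n + 1)) : Y k ≤ unfold Y S k := by
  have := Finset.sum_nonneg fun z hz => ((hS z hz).drop_bounds k).1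
  rw [unfold]; omega

theorem unfold_le_last (hS : ∀ z ∈ S, IsZigzag Y z.1 z.2) {k : Fin (n + 1)}
    (hk : Y k ≤ Y (Fin.last n)) : unfold Y S k ≤ unfold Y S (Fin.last n) := by
  rw [unfold_last hS, unfold]
  have := Finset.sum_le_sum fun z hz => ((hS z hz).drop_bounds k).2
  omega

/-- If all the reflected stretches other than `w` contribute monotonically between `k` and `l`, then
the new increment between `k` and `l` is at least what `w` alone makes of it. -/
theorem le_unfold_sub_unfold {w : Fin (n + 1) × Fin (n + 1)} (hw : w ∈ S) {k l : Fin (n + 1)}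
    (h : ∀ z ∈ S, z ≠ w → drop Y z k ≤ drop Y z l) :
    Y l - Y k + 2 * (drop Y w l - drop Y w k) ≤ unfold Y S l - unfold Y S k := by
  classical
  have h1 := Finset.sum_le_sum (s := S.erase w) (f := fun z => drop Y z k)
    (g := fun z => drop Y z l)
    fun z hz => h z (Finset.mem_of_mem_erase hz) (Finset.ne_of_mem_erase hz)
  have h2 := Finset.add_sum_erase S (fun z => drop Y z k) hw
  have h3 := Finset.add_sum_erase S (fun z => drop Y z l) hw
  simp only [unfold]
  omega

/-- The stretches other than `w` are disjoint from it and only help. Reflecting `w` sends the part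
below its top above it, and lifts what follows by twice the height of `w`, hence above the top too.
-/
theorem isRenewal_unfold_fst (hS : ∀ z ∈ S, IsZigzag Y z.1 z.2)
    {w : Fin (n + 1) × Fin (n + 1)} (hw : w ∈ S) : IsRenewal (unfold Y S) w.1 := by
  have hW := hS w hw
  have hp := hW.height_pos
  constructor
  · intro k hk
    have h1 := le_unfold_sub_unfold (Y := Y) hw (k := k) (l := w.1) fun z hz hne => by
      rcases (hS z hz).disjoint hW hne with h | h
      · rw [(hS z hz).drop_of_ge h.le]; exact ((hS z hz).drop_bounds k).2
      · rw [(hS z hz).drop_of_le (hk.trans (hW.lt.trans h).le)]; exact ((hS z hz).drop_bounds _).1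
    rw [hW.drop_of_le hk, hW.drop_of_le le_rfl] at h1
    have := hW.le_top k hk
    omega
  · intro k hk
    have h1 := le_unfold_sub_unfold (Y := Y) hw (k := w.1) (l := k) fun z hz hne => by
      rcases (hS z hz).disjoint hW hne with h | h
      · rw [(hS z hz).drop_of_ge h.le, (hS z hz).drop_of_ge (h.trans hk).le]
      · rw [(hS z hz).drop_of_le (hW.lt.trans h).le]; exact ((hS z hz).drop_bounds _).1
    rw [hW.drop_of_le le_rfl] at h1
    rcases le_or_gt k w.2 with h | h
    · rw [drop_of_mem hk.le h] at h1
      have := hW.lt_top k hk h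
      omega
    · rw [hW.drop_of_ge h.le] at h1
      have := hW.bot_lt k h
      omega

/-- The bottom of `w`, a future minimum, becomes the highest point of the reflected stretch and is
lifted together with its future. -/
theorem isRenewal_unfold_snd (hS : ∀ z ∈ S, IsZigzag Y z.1 z.2)
    {w : Fin (n + 1) × Fin (n + 1)} (hw : w ∈ S) : IsRenewal (unfold Y S) w.2 := by
  have hW := hS w hw
  have hp := hW.height_pos
  constructor
  · intro k hk
    have h1 := le_unfold_sub_unfold (Y := Y) hw (k := k) (l := w.2) fun z hz hne => by
      rcases (hS z hz).disjoint hW hne with h | h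
      · rw [(hS z hz).drop_of_ge (h.trans hW.lt).le]; exact ((hS z hz).drop_bounds k).2
      · rw [(hS z hz).drop_of_le (hk.trans h.le)]; exact ((hS z hz).drop_bounds _).1
    rw [hW.drop_of_ge le_rfl] at h1
    rcases le_or_gt k w.1 with h | h
    · rw [hW.drop_of_le h] at h1
      have := hW.le_top k h
      omega
    · rw [drop_of_mem h.le hk] at h1
      have := hW.bot_le k h.le hk
      omega
  · intro k hk
    have h1 := le_unfold_sub_unfold (Y := Y) hw (k := w.2) (l := k) fun z hz hne => by
      rcases (hS z hz).disjoint hW hne with h | h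
      · rw [(hS z hz).drop_of_ge (h.trans hW.lt).le,
          (hS z hz).drop_of_ge ((h.trans hW.lt).trans hk).le]
      · rw [(hS z hz).drop_of_le h.le]; exact ((hS z hz).drop_bounds _).1
    rw [hW.drop_of_ge le_rfl, hW.drop_of_ge hk.le] at h1
    have := hW.bot_lt k hk
    omega

theorem unfold_snd_sub_fst (hS : ∀ z ∈ S, IsZigzag Y z.1 z.2)
    {w : Fin (n + 1) × Fin (n + 1)} (hw : w ∈ S) :
    unfold Y S w.2 - unfold Y S w.1 = Y w.1 - Y w.2 := by
  classical
  have hW := hS w hw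
  have key : ∑ z ∈ S, (drop Y z w.2 - drop Y z w.1) = Y w.1 - Y w.2 := by
    rw [Finset.sum_eq_single_of_mem w hw, hW.drop_of_ge le_rfl, hW.drop_of_le le_rfl, sub_zero]
    intro z hz hne
    rcases (hS z hz).disjoint hW hne with h | h
    · rw [(hS z hz).drop_of_ge h.le, (hS z hz).drop_of_ge (h.trans hW.lt).le, sub_self]
    · rw [(hS z hz).drop_of_le h.le, (hS z hz).drop_of_le (hW.lt.trans h).le, sub_self]
  rw [Finset.sum_sub_distrib] at key
  simp only [unfold]
  omega

open Classical in
/-- Between two times with no strictly intermediate end point of a stretch of `S`, increments are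
preserved up to a sign that depends only on `S`. -/
theorem unfold_sub_unfold (hS : ∀ z ∈ S, IsZigzag Y z.1 z.2) {k l : Fin (n + 1)} (hkl : k < l)
    (h : ∀ z ∈ S, (z.1 ≤ k ∨ l ≤ z.1) ∧ (z.2 ≤ k ∨ l ≤ z.2)) :
    unfold Y S l - unfold Y S k =
      (if ∃ z ∈ S, z.1 ≤ k ∧ l ≤ z.2 then -1 else 1) * (Y l - Y k) := by
  have hd : ∀ z ∈ S, ¬(z.1 ≤ k ∧ l ≤ z.2) → drop Y z l - drop Y z k = 0 := by
    intro z hz hn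
    have hz1 := (hS z hz).lt
    rcases (h z hz).1 with h1 | h1
    · rcases (h z hz).2 with h2 | h2
      · rw [(hS z hz).drop_of_ge h2, (hS z hz).drop_of_ge (h2.trans hkl.le), sub_self]
      · exact absurd ⟨h1, h2⟩ hn
    · rw [(hS z hz).drop_of_le h1, (hS z hz).drop_of_le (hkl.le.trans h1), sub_self]
  have hsum : unfold Y S l - unfold Y S k =
      Y l - Y k + 2 * ∑ z ∈ S, (drop Y z l - drop Y z k) := by
    rw [Finset.sum_sub_distrib]; simp only [unfold]; ring
  rw [hsum]
  split_ifs with hex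
  · obtain ⟨w, hw, h1, h2⟩ := hex
    rw [Finset.sum_eq_single_of_mem w hw, drop_of_mem (h1.trans hkl.le) h2,
      drop_of_mem h1 (hkl.le.trans h2)]
    · ring
    · intro z hz hne
      refine hd z hz ?_
      rintro ⟨h3, h4⟩
      rcases (hS z hz).disjoint (hS w hw) hne with h5 | h5
      · exact absurd (hkl.trans_le (h4.trans (h5.le.trans h1))) (lt_irrefl _)
      · exact absurd (hkl.trans_le (h2.trans (h5.le.trans h3))) (lt_irrefl _)
  · push Not at hex
    rw [Finset.sum_eq_zero]
    · ring
    · exact fun z hz => hd z hz fun hc => absurd (hex z hz hc.1) (not_lt.2 hc.2)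

open Classical in
theorem unfold_succ_sub (hS : ∀ z ∈ S, IsZigzag Y z.1 z.2) (k : Fin n) :
    unfold Y S k.succ - unfold Y S k.castSucc =
      (if ∃ z ∈ S, z.1 ≤ k.castSucc ∧ k.succ ≤ z.2 then -1 else 1) *
        (Y k.succ - Y k.castSucc) := by
  refine unfold_sub_unfold hS Fin.castSucc_lt_succ fun z _ => ⟨?_, ?_⟩ <;>
  · rw [← Fin.castSucc_lt_iff_succ_le]; exact le_or_gt _ _

/-- Each increment changes by a sign that depends on `S` alone, so the old increments can be read
off from the new ones. -/
theorem unfold_injective {Y₁ Y₂ : Fin (n + 1) → ℤ} (h₁ : ∀ z ∈ S, IsZigzag Y₁ z.1 z.2)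
    (h₂ : ∀ z ∈ S, IsZigzag Y₂ z.1 z.2) (h : unfold Y₁ S = unfold Y₂ S) : Y₁ = Y₂ := by
  classical
  funext k
  induction k using Fin.induction with
  | zero => rw [← unfold_zero h₁, h, unfold_zero h₂]
  | succ k ih =>
    have e₁ := unfold_succ_sub h₁ k
    have e₂ := unfold_succ_sub h₂ k
    rw [h, e₂] at e₁
    split_ifs at e₁ <;> omega

end Zigzag

/-! ### Unfolding bridges. -/

section Walk

variable {d : ℕ} (hd : 2 ≤ d) {n : ℕ}

/-- The sequence of `y`-coordinates of a walk. -/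
def profile (γ : Fin (n + 1) → Lattice d) (k : Fin (n + 1)) : ℤ := yCoord hd (γ k)

/-- The walk whose `y`-coordinates are reflected along each of the stretches in `S`. -/
def unfoldWalk (γ : Fin (n + 1) → Lattice d) (S : Finset (Fin (n + 1) × Fin (n + 1)))
    (k : Fin (n + 1)) : Lattice d :=
  Function.update (γ k) ⟨1, hd⟩ (unfold (profile hd γ) S k)

variable {hd} {γ : Fin (n + 1) → Lattice d} {S : Finset (Fin (n + 1) × Fin (n + 1))}

theorem profile_unfoldWalk : profile hd (unfoldWalk hd γ S) = unfold (profile hd γ) S := by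
  funext k; simp [profile, yCoord, unfoldWalk]

theorem ext_of_profile {u w : Lattice d} (hy : yCoord hd u = yCoord hd w)
    (h : ∀ i, i ≠ ⟨1, hd⟩ → u i = w i) : u = w := by
  funext i
  by_cases hi : i = ⟨1, hd⟩
  · rw [hi]; exact hy
  · exact h i hi

theorem adjacent_unfoldWalk (hS : ∀ z ∈ S, IsZigzag (profile hd γ) z.1 z.2) (k : Fin n)
    (h : Adjacent (γ k.castSucc) (γ k.succ)) :
    Adjacent (unfoldWalk hd γ S k.castSucc) (unfoldWalk hd γ S k.succ) := by
  classical
  unfold Adjacent at *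
  rw [← h]
  refine Finset.sum_congr rfl fun i _ => ?_
  by_cases hi : i = ⟨1, hd⟩
  · subst hi
    simp only [unfoldWalk, Function.update_self]
    rw [abs_sub_comm, unfold_succ_sub hS k, abs_mul, abs_sub_comm (γ _ _)]
    split_ifs <;> simp [profile, yCoord]
  · simp [unfoldWalk, hi]

/-- Two times separated by an end of a stretch are at different heights, since that end is now a
renewal. Otherwise their height difference changes at most in sign, so a collision would already
occur in `γ`. -/
theorem unfoldWalk_ne (hS : ∀ z ∈ S, IsZigzag (profile hd γ) z.1 z.2)
    (hγ : Function.Injective γ) {k l : Fin (n + 1)} (hkl : k < l) :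
    unfoldWalk hd γ S k ≠ unfoldWalk hd γ S l := by
  classical
  intro heq
  have hy : unfold (profile hd γ) S k = unfold (profile hd γ) S l := by
    rw [← profile_unfoldWalk]; simp only [profile, heq]
  by_cases hm : ∀ z ∈ S, (z.1 ≤ k ∨ l ≤ z.1) ∧ (z.2 ≤ k ∨ l ≤ z.2)
  · have h1 := unfold_sub_unfold hS hkl hm
    refine hkl.ne (hγ (ext_of_profile (hd := hd) ?_ fun i hi => ?_))
    · change profile hd γ k = profile hd γ l
      split_ifs at h1 <;> omega
    · have := congrFun heq i
      simpa [unfoldWalk, hi] using this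
  · push Not at hm
    obtain ⟨z, hz, hz'⟩ := hm
    by_cases h1 : k < z.1 ∧ z.1 < l
    · have hr := isRenewal_unfold_fst hS hz
      have := hr.le k h1.1.le
      have := hr.lt l h1.2
      omega
    · have h2 := hz' (by rw [not_and_or, not_lt, not_lt] at h1; exact h1)
      have hr := isRenewal_unfold_snd hS hz
      have := hr.le k h2.1.le
      have := hr.lt l h2.2
      omega

theorem unfoldWalk_mem_SAB (hγ : γ ∈ SAB hd n)
    (hS : ∀ z ∈ S, IsZigzag (profile hd γ) z.1 z.2) : unfoldWalk hd γ S ∈ SAB hd n := by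
  obtain ⟨h0, ⟨⟨hw, hinj⟩, hfirst, hlast⟩⟩ := hγ
  have hp : ∀ k, yCoord hd (unfoldWalk hd γ S k) = unfold (profile hd γ) S k :=
    congrFun profile_unfoldWalk
  refine ⟨?_, ⟨fun k => adjacent_unfoldWalk hS k (hw k), fun k l hkl => ?_⟩, fun k hk => ?_,
    fun k => ?_⟩
  · refine ext_of_profile (hd := hd) ?_ fun i hi => ?_
    · rw [hp, unfold_zero hS, profile, h0]
    · simp [unfoldWalk, hi, h0]
  · by_contra hne
    rcases lt_or_gt_of_ne hne with h | h
    · exact unfoldWalk_ne hS hinj h hkl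
    · exact unfoldWalk_ne hS hinj h hkl.symm
  · rw [hp, hp, unfold_zero hS]
    exact (hfirst k hk).trans_le (le_unfold hS k)
  · rw [hp, hp]
    exact unfold_le_last hS (hlast k)

theorem unfoldWalk_injective {γ₁ γ₂ : Fin (n + 1) → Lattice d}
    (h₁ : ∀ z ∈ S, IsZigzag (profile hd γ₁) z.1 z.2)
    (h₂ : ∀ z ∈ S, IsZigzag (profile hd γ₂) z.1 z.2)
    (h : unfoldWalk hd γ₁ S = unfoldWalk hd γ₂ S) : γ₁ = γ₂ := by
  have hp := unfold_injective h₁ h₂ (by rw [← profile_unfoldWalk, h, profile_unfoldWalk])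
  funext k
  refine ext_of_profile (hd := hd) (congrFun hp k) fun i hi => ?_
  have := congrFun (congrFun h k) i
  simpa [unfoldWalk, hi] using this

theorem profile_zero (hγ : γ ∈ SAB hd n) : profile hd γ 0 = 0 := by
  rw [profile, hγ.1]; rfl

theorem profile_step (hγ : γ ∈ SAB hd n) (k : Fin n) :
    profile hd γ k.succ ≤ profile hd γ k.castSucc + 1 := by
  have h : ∑ i, |γ k.castSucc i - γ k.succ i| = 1 := hγ.2.selfAvoiding.1 k
  have h1 := Finset.single_le_sum (f := fun i => |γ k.castSucc i - γ k.succ i|)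
    (fun _ _ => abs_nonneg _) (Finset.mem_univ ⟨1, hd⟩)
  rw [h] at h1
  have h2 := (abs_le.1 h1).1
  simp only [profile, yCoord]
  omega

theorem profile_le (hγ : γ ∈ SAB hd n) (k : Fin (n + 1)) : profile hd γ k ≤ k := by
  induction k using Fin.induction with
  | zero => simp [profile_zero hγ]
  | succ k ih =>
    have := profile_step hγ k
    simp only [Fin.val_castSucc] at ih
    simp only [Fin.val_succ]
    push_cast
    omega

theorem profile_nonneg (hγ : γ ∈ SAB hd n) (k : Fin (n + 1)) : 0 ≤ profile hd γ k := by
  rcases eq_or_ne k 0 with rfl | hk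
  · rw [profile_zero hγ]
  · have := hγ.2.first_lt k hk
    rw [← profile_zero hγ]; exact this.le

theorem mem_renewalPoints (hγ : γ ∈ SAB hd n) {i : Fin (n + 1)}
    (hi : IsRenewal (profile hd γ) i) : γ i ∈ renewalPoints hd γ := by
  obtain ⟨h0, ⟨⟨hw, hinj⟩, hfirst, hlast⟩⟩ := hγ
  have hsub : ∀ (a b : ℕ) (hab : a ≤ b) (hb : b ≤ n), IsSelfAvoiding (subwalk γ a b hab hb) := by
    intro a b hab hb
    refine ⟨fun k => hw ⟨a + k, by omega⟩, fun k l hkl => ?_⟩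
    have := congrArg Fin.val (hinj hkl)
    simp only at this
    exact Fin.ext (by omega)
  refine ⟨i, by omega, rfl, ⟨hsub _ _ _ _, fun k hk => ?_, fun k => ?_⟩,
    ⟨hsub _ _ _ _, fun k hk => ?_, fun k => ?_⟩⟩
  · refine hfirst ⟨0 + k, by omega⟩ fun h => hk (Fin.ext ?_)
    simpa using congrArg Fin.val h
  · have h1 : subwalk γ 0 i (Nat.zero_le _) (by omega) (Fin.last (i - 0)) = γ i :=
      congrArg γ (Fin.ext (by simp))
    rw [h1]
    exact hi.le ⟨0 + k, by omega⟩ (Fin.le_def.2 (by simp only; omega))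
  · refine hi.lt ⟨i + k, by omega⟩ (Fin.lt_def.2 ?_)
    have : (k : ℕ) ≠ 0 := fun h => hk (Fin.ext h)
    simp only; omega
  · convert hlast ⟨i + k, by omega⟩ using 3
    simp only [subwalk]
    exact congrArg γ (Fin.ext (by simp only [Fin.val_last]; omega))

end Walk

/-! ### Covering the levels by renewals and zigzags. -/

section Counting

open Classical

variable {n : ℕ} (Y : Fin (n + 1) → ℤ)

/-- The zigzags of a height profile. -/
noncomputable def zigzags : Finset (Fin (n + 1) × Fin (n + 1)) :=
  Finset.univ.filter fun z => IsZigzag Y z.1 z.2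

/-- The renewal indices of a height profile. -/
noncomputable def renewals : Finset (Fin (n + 1)) := Finset.univ.filter fun i => IsRenewal Y i

/-- The height of a zigzag. -/
def zigzagHeight (z : Fin (n + 1) × Fin (n + 1)) : ℕ := (Y z.1 - Y z.2).toNat

variable {Y}

theorem mem_zigzags {z : Fin (n + 1) × Fin (n + 1)} :
    z ∈ zigzags Y ↔ IsZigzag Y z.1 z.2 := by simp [zigzags]

theorem mem_renewals {i : Fin (n + 1)} : i ∈ renewals Y ↔ IsRenewal Y i := by simp [renewals]

theorem IsZigzag.coe_zigzagHeight {z : Fin (n + 1) × Fin (n + 1)} (hz : IsZigzag Y z.1 z.2) :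
    (zigzagHeight Y z : ℤ) = Y z.1 - Y z.2 :=
  Int.toNat_of_nonneg (by have := hz.height_pos; omega)

theorem card_renewals_le : (renewals Y).card ≤ n + 1 := by
  simpa using Finset.card_le_univ (renewals Y)

theorem last_sub_zero_le (hstep : ∀ k : Fin n, Y k.succ ≤ Y k.castSucc + 1) :
    Y (Fin.last n) - Y 0 ≤ (renewals Y).card + ∑ z ∈ zigzags Y, (zigzagHeight Y z : ℤ) := by
  have hsub : Finset.Ico (Y 0) (Y (Fin.last n)) ⊆
      (renewals Y).image Y ∪ (zigzags Y).biUnion fun z => Finset.Ico (Y z.2) (Y z.1) := by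
    intro h hh
    rw [Finset.mem_Ico] at hh
    rcases exists_renewal_or_zigzag hh.1 hh.2 hstep with ⟨i, hi, rfl⟩ | ⟨i, j, hz, h1, h2⟩
    · exact Finset.mem_union_left _ (Finset.mem_image_of_mem _ (mem_renewals.2 hi))
    · refine Finset.mem_union_right _ (Finset.mem_biUnion.2 ⟨(i, j), mem_zigzags.2 hz, ?_⟩)
      exact Finset.mem_Ico.2 ⟨h1, h2⟩
  have h1 := (Finset.card_le_card hsub).trans (Finset.card_union_le _ _)
  have h2 : ((renewals Y).image Y).card ≤ (renewals Y).card := Finset.card_image_le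
  have h3 : ((zigzags Y).biUnion fun z => Finset.Ico (Y z.2) (Y z.1)).card ≤
      ∑ z ∈ zigzags Y, zigzagHeight Y z :=
    Finset.card_biUnion_le.trans (Finset.sum_le_sum fun z _ => by simp [zigzagHeight])
  rw [Int.card_Ico] at h1
  have h4 : (∑ z ∈ zigzags Y, (zigzagHeight Y z : ℤ)) =
      ((∑ z ∈ zigzags Y, zigzagHeight Y z : ℕ) : ℤ) := by
    push_cast; rfl
  rw [h4]
  omega

end Counting

/-! ### The weighted inequality between zigzags and renewals. -/

section Master

open Classical

variable {d : ℕ} (hd : 2 ≤ d) (n : ℕ)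

/-- The finite set of bridges of length `n` that start at the origin. -/
noncomputable def bridges : Finset (Fin (n + 1) → Lattice d) := (SAB_finite hd n).toFinset

/-- The final height of a walk. -/
def endHeight {n : ℕ} (γ : Fin (n + 1) → Lattice d) : ℕ := (profile hd γ (Fin.last n)).toNat

variable {hd n}

theorem mem_bridges {γ : Fin (n + 1) → Lattice d} : γ ∈ bridges hd n ↔ γ ∈ SAB hd n := by
  simp [bridges]

theorem coe_endHeight {γ : Fin (n + 1) → Lattice d} (hγ : γ ∈ SAB hd n) :
    (endHeight hd γ : ℤ) = profile hd γ (Fin.last n) :=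
  Int.toNat_of_nonneg (profile_nonneg hγ _)

theorem endHeight_le {γ : Fin (n + 1) → Lattice d} (hγ : γ ∈ SAB hd n) : endHeight hd γ ≤ n := by
  have h1 := profile_le hγ (Fin.last n)
  have h2 := coe_endHeight hγ
  simp only [Fin.val_last] at h1
  omega

/-- The marks left by the stretches of `S`: their starting indices and heights. -/
noncomputable def marks (Y : Fin (n + 1) → ℤ) (S : Finset (Fin (n + 1) × Fin (n + 1))) :
    Finset (Fin (n + 1) × ℕ) :=
  S.image fun z => (z.1, zigzagHeight Y z)

theorem marks_injOn {Y : Fin (n + 1) → ℤ} {S : Finset (Fin (n + 1) × Fin (n + 1))}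
    (hS : ∀ z ∈ S, IsZigzag Y z.1 z.2) :
    Set.InjOn (fun z : Fin (n + 1) × Fin (n + 1) => (z.1, zigzagHeight Y z)) S := by
  intro z hz w hw h
  have h1 : z.1 = w.1 := (Prod.ext_iff.1 h).1
  refine Prod.ext h1 ((hS z hz).snd_eq ?_)
  rw [h1]; exact hS w hw

/-- A mark gives the start of a stretch and the height that the reflected stretch gains. Its end is
a renewal of the unfolded profile, and a renewal is determined by its height. -/
theorem subset_of_marks_eq {Y₁ Y₂ : Fin (n + 1) → ℤ} {S₁ S₂ : Finset (Fin (n + 1) × Fin (n + 1))}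
    (h₁ : ∀ z ∈ S₁, IsZigzag Y₁ z.1 z.2) (h₂ : ∀ z ∈ S₂, IsZigzag Y₂ z.1 z.2)
    (hY : unfold Y₁ S₁ = unfold Y₂ S₂) (hm : marks Y₁ S₁ = marks Y₂ S₂) : S₁ ⊆ S₂ := by
  intro z hz
  have hzm : (z.1, zigzagHeight Y₁ z) ∈ marks Y₂ S₂ := hm ▸ Finset.mem_image_of_mem _ hz
  obtain ⟨w, hw, hwz⟩ := Finset.mem_image.1 hzm
  have e1 : w.1 = z.1 := (Prod.ext_iff.1 hwz).1
  have e2 : zigzagHeight Y₂ w = zigzagHeight Y₁ z := (Prod.ext_iff.1 hwz).2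
  have a1 := unfold_snd_sub_fst h₁ hz
  have a2 := unfold_snd_sub_fst h₂ hw
  have b1 := (h₁ z hz).coe_zigzagHeight
  have b2 := (h₂ w hw).coe_zigzagHeight
  have r1 := isRenewal_unfold_snd h₁ hz
  have r2 := isRenewal_unfold_snd h₂ hw
  rw [hY] at a1 r1
  rw [e1] at a2
  have e3 : z.2 = w.2 := r1.eq_of_height_eq r2 (by rw [e1] at b2; omega)
  rw [Prod.ext e1.symm e3]; exact hw

theorem marks_subset {γ : Fin (n + 1) → Lattice d} {S : Finset (Fin (n + 1) × Fin (n + 1))}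
    (hγ : γ ∈ SAB hd n) (hS : ∀ z ∈ S, IsZigzag (profile hd γ) z.1 z.2) :
    marks (profile hd γ) S ⊆
      renewals (profile hd (unfoldWalk hd γ S)) ×ˢ Finset.Icc 1 n := by
  intro x hx
  obtain ⟨z, hz, rfl⟩ := Finset.mem_image.1 hx
  rw [Finset.mem_product, mem_renewals, profile_unfoldWalk, Finset.mem_Icc]
  have h1 := (hS z hz).coe_zigzagHeight
  have h2 := (hS z hz).height_pos
  have h3 := profile_le hγ z.1
  have h4 := profile_nonneg hγ z.2
  exact ⟨isRenewal_unfold_fst hS hz, by simp only; omega, by simp only; omega⟩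

theorem endHeight_unfoldWalk {γ : Fin (n + 1) → Lattice d}
    {S : Finset (Fin (n + 1) × Fin (n + 1))} (hγ : γ ∈ SAB hd n)
    (hS : ∀ z ∈ S, IsZigzag (profile hd γ) z.1 z.2) :
    endHeight hd (unfoldWalk hd γ S) =
      endHeight hd γ + 2 * ∑ z ∈ S, zigzagHeight (profile hd γ) z := by
  have h1 := coe_endHeight hγ
  have h2 := coe_endHeight (unfoldWalk_mem_SAB hγ hS)
  rw [profile_unfoldWalk, unfold_last hS,
    ← Finset.sum_congr rfl fun z hz => (hS z hz).coe_zigzagHeight, ← Nat.cast_sum, ← h1] at h2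
  omega

/-- Unfolding an arbitrary set of zigzags of each bridge gives a weighted comparison between
numbers of zigzags and numbers of renewals. -/
theorem sum_zigzags_le_sum_renewals {t : ℝ} (ht : 0 ≤ t) {f : ℕ → ℝ} (hf : ∀ r, 0 ≤ f r) :
    ∑ γ ∈ bridges hd n, t ^ endHeight hd γ * ∏ z ∈ zigzags (profile hd γ),
        (1 + f (zigzagHeight (profile hd γ) z) * t ^ (2 * zigzagHeight (profile hd γ) z)) ≤
      ∑ γ ∈ bridges hd n, t ^ endHeight hd γ *
        (∏ r ∈ Finset.Icc 1 n, (1 + f r)) ^ (renewals (profile hd γ)).card := by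
  set D : Finset ((γ : Fin (n + 1) → Lattice d) × Finset (Fin (n + 1) × Fin (n + 1))) :=
    (bridges hd n).sigma fun γ => (zigzags (profile hd γ)).powerset with hD
  set T : Finset ((γ : Fin (n + 1) → Lattice d) × Finset (Fin (n + 1) × ℕ)) :=
    (bridges hd n).sigma fun γ =>
      (renewals (profile hd γ) ×ˢ Finset.Icc 1 n).powerset with hT
  let e : ((γ : Fin (n + 1) → Lattice d) × Finset (Fin (n + 1) × Fin (n + 1))) →
      ((γ : Fin (n + 1) → Lattice d) × Finset (Fin (n + 1) × ℕ)) :=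
    fun x => ⟨unfoldWalk hd x.1 x.2, marks (profile hd x.1) x.2⟩
  let w : ((γ : Fin (n + 1) → Lattice d) × Finset (Fin (n + 1) × ℕ)) → ℝ :=
    fun x => t ^ endHeight hd x.1 * ∏ m ∈ x.2, f m.2
  have hDmem : ∀ x ∈ D, x.1 ∈ SAB hd n ∧ ∀ z ∈ x.2, IsZigzag (profile hd x.1) z.1 z.2 := by
    intro x hx
    rw [hD, Finset.mem_sigma, Finset.mem_powerset, mem_bridges] at hx
    exact ⟨hx.1, fun z hz => mem_zigzags.1 (hx.2 hz)⟩
  -- Expanding the product sums over the sets `S` of zigzags; the factors `t ^ (2 * r)` account for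
  -- the height gained by unfolding.
  have hL : ∑ γ ∈ bridges hd n, t ^ endHeight hd γ * ∏ z ∈ zigzags (profile hd γ),
        (1 + f (zigzagHeight (profile hd γ) z) * t ^ (2 * zigzagHeight (profile hd γ) z)) =
      ∑ x ∈ D, w (e x) := by
    rw [hD, Finset.sum_sigma]
    refine Finset.sum_congr rfl fun γ hγ => ?_
    rw [Finset.prod_one_add, Finset.mul_sum]
    refine Finset.sum_congr rfl fun S hS => ?_
    obtain ⟨h1, h2⟩ := hDmem ⟨γ, S⟩ (by rw [hD, Finset.mem_sigma]; exact ⟨hγ, hS⟩)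
    simp only [w, e]
    rw [endHeight_unfoldWalk h1 h2, marks, Finset.prod_image (marks_injOn h2),
      Finset.prod_mul_distrib, Finset.prod_pow_eq_pow_sum, ← Finset.mul_sum, pow_add]
    ring
  -- Here the expansion runs over all sets of pairs of a renewal and a height in `[1, n]`, including
  -- those that are not marks of any unfolding.
  have hR : ∑ γ ∈ bridges hd n, t ^ endHeight hd γ *
        (∏ r ∈ Finset.Icc 1 n, (1 + f r)) ^ (renewals (profile hd γ)).card =
      ∑ x ∈ T, w x := by
    rw [hT, Finset.sum_sigma]
    refine Finset.sum_congr rfl fun γ _ => ?_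
    simp only [w]
    rw [← Finset.mul_sum, ← Finset.prod_one_add, Finset.prod_product]
    simp only [Finset.prod_const]
  rw [hL, hR, ← Finset.sum_image (f := w) (g := e)]
  · refine Finset.sum_le_sum_of_subset_of_nonneg ?_ fun x _ _ =>
      mul_nonneg (pow_nonneg ht _) (Finset.prod_nonneg fun _ _ => hf _)
    intro y hy
    obtain ⟨x, hx, rfl⟩ := Finset.mem_image.1 hy
    obtain ⟨h1, h2⟩ := hDmem x hx
    rw [hT, Finset.mem_sigma, Finset.mem_powerset, mem_bridges]
    exact ⟨unfoldWalk_mem_SAB h1 h2, marks_subset h1 h2⟩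
  -- The image and the marks determine `S`; the image and `S` then determine the bridge.
  · rintro ⟨γ₁, S₁⟩ hx₁ ⟨γ₂, S₂⟩ hx₂ h
    obtain ⟨-, h1⟩ := hDmem _ hx₁
    obtain ⟨-, h2⟩ := hDmem _ hx₂
    simp only [e, Sigma.mk.injEq, heq_eq_eq] at h
    have hY : unfold (profile hd γ₁) S₁ = unfold (profile hd γ₂) S₂ := by
      rw [← profile_unfoldWalk, h.1, profile_unfoldWalk]
    obtain rfl : S₁ = S₂ := (subset_of_marks_eq h1 h2 hY h.2).antisymm
      (subset_of_marks_eq h2 h1 hY.symm h.2.symm)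
    exact Sigma.ext (unfoldWalk_injective h1 h2 h.1) HEq.rfl

end Master

/-! ### Exponentially rare events. -/

section Rare

open Classical

variable {d : ℕ} (hd : 2 ≤ d)

/-- The number of bridges of length `n` that have the property `E`. -/
noncomputable def bridgeCount (n : ℕ) (E : Set (Fin (n + 1) → Lattice d)) : ℝ :=
  (((bridges hd n).filter (· ∈ E)).card : ℝ)

/-- The proportion of bridges with the property `E n` decays exponentially in `n`. -/
def IsRare (E : ∀ n, Set (Fin (n + 1) → Lattice d)) : Prop :=
  ∃ c : ℝ, 0 < c ∧ ∀ᶠ n : ℕ in atTop,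
    bridgeCount hd n (E n) ≤ Real.exp (-(c * n)) * (bridges hd n).card

variable {hd}

theorem card_bridges_pos (n : ℕ) : (0 : ℝ) < (bridges hd n).card := by
  obtain ⟨γ, hγ⟩ := SAB_nonempty hd n
  exact_mod_cast Finset.card_pos.2 ⟨γ, mem_bridges.2 hγ⟩

theorem bridgeLaw_eq (n : ℕ) (E : Set (Fin (n + 1) → Lattice d)) :
    bridgeLaw hd n E = ENNReal.ofReal (bridgeCount hd n E / (bridges hd n).card) := by
  have h1 : SAB hd n = (bridges hd n : Set (Fin (n + 1) → Lattice d)) := by simp [bridges]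
  have h2 : (bridges hd n : Set (Fin (n + 1) → Lattice d)) ∩ E =
      ((bridges hd n).filter (· ∈ E) : Finset _) := by ext; simp
  rw [bridgeLaw, ← uniformOn_inter_self (SAB_finite hd n), h1, h2, uniformOn_apply_finset,
    Finset.inter_eq_right.2 (Finset.filter_subset _ _),
    ENNReal.ofReal_div_of_pos (card_bridges_pos n), bridgeCount, ENNReal.ofReal_natCast,
    ENNReal.ofReal_natCast]

theorem bridgeLaw_le_iff (n : ℕ) (E : Set (Fin (n + 1) → Lattice d)) (x : ℝ) :
    bridgeLaw hd n E ≤ ENNReal.ofReal (Real.exp x) ↔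
      bridgeCount hd n E ≤ Real.exp x * (bridges hd n).card := by
  rw [bridgeLaw_eq, ENNReal.ofReal_le_ofReal_iff (Real.exp_pos x).le,
    div_le_iff₀ (card_bridges_pos n)]

theorem log_div_le_iff {n : ℕ} (hn : n ≠ 0) (p : ENNReal) (c : ℝ) :
    ENNReal.log p / (n : EReal) ≤ ((-c : ℝ) : EReal) ↔
      p ≤ ENNReal.ofReal (Real.exp (-(c * n))) := by
  have h0 : (0 : EReal) < (n : EReal) := by exact_mod_cast Nat.pos_of_ne_zero hn
  rw [EReal.div_le_iff_le_mul h0 (EReal.natCast_ne_top n), ← ENNReal.log_le_log_iff,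
    ENNReal.log_ofReal_of_pos (Real.exp_pos _), Real.log_exp,
    ← EReal.coe_natCast, ← EReal.coe_mul,
    show (n : ℝ) * -c = -(c * n) by ring]

/-- Probabilities are at most one, so the limsup is at most zero; being nonzero means lying below
some `-c < 0`, which is exponential decay. -/
theorem isRare_iff (E : ∀ n, Set (Fin (n + 1) → Lattice d)) :
    IsRare hd E ↔
      limsup (fun n : ℕ => ENNReal.log (bridgeLaw hd n (E n)) / (n : EReal)) atTop ≠ 0 := by
  have key : ∀ c : ℝ, ∀ᶠ n : ℕ in atTop,
      (ENNReal.log (bridgeLaw hd n (E n)) / (n : EReal) ≤ ((-c : ℝ) : EReal) ↔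
        bridgeCount hd n (E n) ≤ Real.exp (-(c * n)) * (bridges hd n).card) := by
    intro c
    filter_upwards [eventually_ne_atTop 0] with n hn
    rw [log_div_le_iff hn, bridgeLaw_le_iff]
  constructor
  · rintro ⟨c, hc, h⟩
    have h1 : limsup (fun n : ℕ => ENNReal.log (bridgeLaw hd n (E n)) / (n : EReal)) atTop ≤
        ((-c : ℝ) : EReal) := by
      refine limsup_le_of_le (by isBoundedDefault) ?_
      filter_upwards [h, key c] with n h1 h2 using h2.2 h1
    refine (h1.trans_lt ?_).ne
    exact_mod_cast neg_lt_zero.2 hc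
  · intro h
    have h1 : limsup (fun n : ℕ => ENNReal.log (bridgeLaw hd n (E n)) / (n : EReal)) atTop ≤ 0 := by
      refine limsup_le_of_le (by isBoundedDefault) ?_
      filter_upwards [eventually_ne_atTop 0] with n hn
      have := (log_div_le_iff hn (bridgeLaw hd n (E n)) 0).2 (by simpa using prob_le_one)
      simpa using this
    obtain ⟨x, hx1, hx2⟩ := EReal.lt_iff_exists_real_btwn.1 (lt_of_le_of_ne h1 h)
    refine ⟨-x, neg_pos.2 (by exact_mod_cast hx2), ?_⟩
    filter_upwards [eventually_lt_of_limsup_lt hx1, key (-x)] with n h2 h3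
    exact h3.1 (by simpa using h2.le)

/-- Halving the smaller rate absorbs the factor two for large `n`. -/
theorem IsRare.of_le_exp_add_exp {E : ∀ n, Set (Fin (n + 1) → Lattice d)} {a b : ℝ} (ha : 0 < a)
    (hb : 0 < b)
    (h : ∀ᶠ n : ℕ in atTop, bridgeCount hd n (E n) ≤
      (Real.exp (-(a * n)) + Real.exp (-(b * n))) * (bridges hd n).card) : IsRare hd E := by
  have hc : 0 < min a b := lt_min ha hb
  refine ⟨min a b / 2, by positivity, ?_⟩
  filter_upwards [h, (tendsto_natCast_atTop_atTop (R := ℝ)).eventually_ge_atTop (2 / min a b)]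
    with n hn hn'
  refine hn.trans (mul_le_mul_of_nonneg_right ?_ (card_bridges_pos n).le)
  rw [div_le_iff₀ hc] at hn'
  have h1 : Real.exp (-(a * n)) ≤ Real.exp (-(min a b * n)) :=
    Real.exp_le_exp.2 (neg_le_neg (mul_le_mul_of_nonneg_right (min_le_left _ _) n.cast_nonneg))
  have h2 : Real.exp (-(b * n)) ≤ Real.exp (-(min a b * n)) :=
    Real.exp_le_exp.2 (neg_le_neg (mul_le_mul_of_nonneg_right (min_le_right _ _) n.cast_nonneg))
  have h3 : (2 : ℝ) ≤ Real.exp (min a b / 2 * n) := by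
    have := Real.add_one_le_exp (min a b / 2 * n)
    linarith
  have h4 : Real.exp (-(min a b / 2 * n)) =
      Real.exp (min a b / 2 * n) * Real.exp (-(min a b * n)) := by
    rw [← Real.exp_add]; congr 1; ring
  rw [h4]
  nlinarith [Real.exp_pos (-(min a b * n))]

theorem IsRare.mono {E F : ∀ n, Set (Fin (n + 1) → Lattice d)} (hF : IsRare hd F)
    (h : ∀ᶠ n in atTop, ∀ γ ∈ SAB hd n, γ ∈ E n → γ ∈ F n) : IsRare hd E := by
  obtain ⟨c, hc, hF⟩ := hF
  refine ⟨c, hc, ?_⟩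
  filter_upwards [hF, h] with n h1 h2
  refine le_trans ?_ h1
  refine Nat.cast_le.2 (Finset.card_le_card fun γ hγ => ?_)
  rw [Finset.mem_filter] at hγ ⊢
  exact ⟨hγ.1, h2 γ (mem_bridges.1 hγ.1) hγ.2⟩

theorem IsRare.union {E F : ∀ n, Set (Fin (n + 1) → Lattice d)} (hE : IsRare hd E)
    (hF : IsRare hd F) : IsRare hd fun n => E n ∪ F n := by
  obtain ⟨a, ha, hE⟩ := hE
  obtain ⟨b, hb, hF⟩ := hF
  refine .of_le_exp_add_exp ha hb ?_
  filter_upwards [hE, hF] with n h1 h2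
  have h3 : bridgeCount hd n (E n ∪ F n) ≤ bridgeCount hd n (E n) + bridgeCount hd n (F n) := by
    simp only [bridgeCount, Set.mem_union, Finset.filter_or]
    exact_mod_cast Finset.card_union_le _ _
  linarith

/-- A Markov-type comparison of two weights on bridges. -/
theorem bridgeCount_mul_le {n : ℕ} {E Q : Set (Fin (n + 1) → Lattice d)}
    {w g : (Fin (n + 1) → Lattice d) → ℝ} {a A B : ℝ}
    (hsum : ∑ γ ∈ bridges hd n, w γ ≤ ∑ γ ∈ bridges hd n, g γ) (hw : ∀ γ, 0 ≤ w γ)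
    (hE : ∀ γ ∈ SAB hd n, γ ∈ E → a ≤ w γ) (hA : 0 ≤ A)
    (hgA : ∀ γ ∈ SAB hd n, γ ∉ Q → g γ ≤ A) (hgB : ∀ γ ∈ SAB hd n, g γ ≤ B) :
    bridgeCount hd n E * a ≤ (bridges hd n).card * A + bridgeCount hd n Q * B := by
  have h1 : bridgeCount hd n E * a ≤ ∑ γ ∈ bridges hd n, w γ := by
    rw [bridgeCount, ← nsmul_eq_mul]
    refine (Finset.card_nsmul_le_sum _ w a fun γ hγ => ?_).trans
      (Finset.sum_le_sum_of_subset_of_nonneg (Finset.filter_subset _ _) fun γ _ _ => hw γ)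
    rw [Finset.mem_filter, mem_bridges] at hγ
    exact hE γ hγ.1 hγ.2
  have h2 : ∑ γ ∈ bridges hd n, g γ ≤ bridgeCount hd n Q * B + (bridges hd n).card * A := by
    rw [← Finset.sum_filter_add_sum_filter_not (bridges hd n) (· ∈ Q)]
    refine add_le_add ?_ ?_
    · rw [bridgeCount, ← nsmul_eq_mul]
      refine Finset.sum_le_card_nsmul _ _ _ fun γ hγ => ?_
      rw [Finset.mem_filter, mem_bridges] at hγ
      exact hgB γ hγ.1
    · refine (Finset.sum_le_card_nsmul _ _ A fun γ hγ => ?_).trans ?_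
      · rw [Finset.mem_filter, mem_bridges] at hγ
        exact hgA γ hγ.1 hγ.2
      · rw [nsmul_eq_mul]
        exact mul_le_mul_of_nonneg_right (by exact_mod_cast Finset.card_filter_le _ _) hA
  linarith

end Rare

/-! ### Long zigzags, short zigzags and the descent in height. -/

section Estimates

variable {d : ℕ} {hd : 2 ≤ d}

/-- The total height of the zigzags of height more than `R`. -/
noncomputable def longHeight {n : ℕ} (R : ℕ) (Y : Fin (n + 1) → ℤ) : ℝ :=
  ∑ z ∈ zigzags Y, if R < zigzagHeight Y z then (zigzagHeight Y z : ℝ) else 0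

/-- The total height of the zigzags of height at most `R`. -/
noncomputable def shortHeight {n : ℕ} (R : ℕ) (Y : Fin (n + 1) → ℤ) : ℝ :=
  ∑ z ∈ zigzags Y, if zigzagHeight Y z ≤ R then (zigzagHeight Y z : ℝ) else 0

theorem endHeight_le_renewals_add {n : ℕ} {γ : Fin (n + 1) → Lattice d} (hγ : γ ∈ SAB hd n)
    (R : ℕ) : (endHeight hd γ : ℝ) ≤ (renewals (profile hd γ)).card +
      (shortHeight R (profile hd γ) + longHeight R (profile hd γ)) := by
  have h := last_sub_zero_le (profile_step hγ)
  rw [profile_zero hγ, sub_zero, ← coe_endHeight hγ] at h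
  have h1 : shortHeight R (profile hd γ) + longHeight R (profile hd γ) =
      ∑ z ∈ zigzags (profile hd γ), (zigzagHeight (profile hd γ) z : ℝ) := by
    rw [shortHeight, longHeight, ← Finset.sum_add_distrib]
    refine Finset.sum_congr rfl fun z _ => ?_
    split_ifs <;> first | omega | simp
  rw [h1]
  exact_mod_cast h

theorem prod_one_add_pow_card_le {f : ℕ → ℝ} (hf : ∀ r, 0 ≤ f r) {κ : ℝ} {n : ℕ}
    (hκ : ∑ r ∈ Finset.Icc 1 n, f r ≤ κ) (m : ℕ) :
    (∏ r ∈ Finset.Icc 1 n, (1 + f r)) ^ m ≤ Real.exp (κ * m) := by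
  rw [mul_comm, Real.exp_nat_mul]
  refine pow_le_pow_left₀ (Finset.prod_nonneg fun r _ => by linarith [hf r]) ?_ m
  refine le_trans ?_ (Real.exp_le_exp.2 hκ)
  rw [Real.exp_sum]
  exact Finset.prod_le_prod (fun r _ => by linarith [hf r])
    fun r _ => by linarith [Real.add_one_le_exp (f r)]

theorem exists_tail_sum_le {f : ℕ → ℝ} (hf : Summable f) {ε : ℝ} (hε : 0 < ε) :
    ∃ R : ℕ, 1 ≤ R ∧ ∀ n, ∑ r ∈ Finset.Icc 1 n, (if R < r then f r else 0) ≤ ε := by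
  obtain ⟨s, hs⟩ := summable_iff_vanishing_norm.1 hf ε hε
  refine ⟨s.sup id + 1, by omega, fun n => ?_⟩
  rw [← Finset.sum_filter]
  refine (le_abs_self _).trans (hs _ (Finset.disjoint_left.2 fun r hr hrs => ?_)).le
  have h1 : r ≤ s.sup id := Finset.le_sup (f := id) hrs
  have := (Finset.mem_filter.1 hr).2
  omega

/-- If bridges cannot be taller than `3v/2` at subexponential cost, then zigzags above a large
threshold are rarely of total height `2v/5` in bridges of height `v`. -/
theorem exists_isRare_longHeight {v : ℝ} (hv : 0 < v)
    (h : IsRare hd fun n => {γ | 3 / 2 * v * n ≤ (endHeight hd γ : ℝ)}) :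
    ∃ R : ℕ, 1 ≤ R ∧ IsRare hd fun n =>
      {γ | v * n ≤ (endHeight hd γ : ℝ) ∧ 2 / 5 * v * n ≤ longHeight R (profile hd γ)} := by
  obtain ⟨c, hc, h⟩ := h
  -- On the exceptional set the height is only bounded by `n`, and the resulting factor `exp (s *
  -- n)` must be beaten by `exp (-(c * n))`.
  set s : ℝ := c / 4 with hs
  have hs0 : 0 < s := by positivity
  have hsum : Summable fun r : ℕ => Real.exp (-(s / 2)) ^ r :=
    summable_geometric_of_lt_one (Real.exp_pos _).le
      (by rw [← Real.exp_zero, Real.exp_lt_exp]; linarith)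
  -- There are at most `n + 1 ≤ 2 * n` renewals, so this tail bounds the cost of the marks by `exp
  -- (s * v / 20 * n)`.
  obtain ⟨R, hR, htail⟩ := exists_tail_sum_le hsum
    (show 0 < s * v / 40 by positivity)
  refine ⟨R, hR, .of_le_exp_add_exp (a := s * v / 20) (b := 3 * s) (by positivity)
    (by positivity) ?_⟩
  filter_upwards [h, eventually_ge_atTop 1] with n hn hn1
  have hn1' : (1 : ℝ) ≤ n := by exact_mod_cast hn1
  set f : ℕ → ℝ := fun r => if R < r then Real.exp (-(s / 2)) ^ r else 0 with hf
  have hf0 : ∀ r, 0 ≤ f r := fun r => by simp only [hf]; split_ifs <;> positivity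
  have hren : ∀ γ : Fin (n + 1) → Lattice d,
      (∏ r ∈ Finset.Icc 1 n, (1 + f r)) ^ (renewals (profile hd γ)).card ≤
        Real.exp (s * v / 20 * n) := by
    intro γ
    refine (prod_one_add_pow_card_le hf0 (htail n) _).trans (Real.exp_le_exp.2 ?_)
    have h1 : ((renewals (profile hd γ)).card : ℝ) ≤ n + 1 := by exact_mod_cast card_renewals_le
    have h2 : 0 < s * v := by positivity
    nlinarith
  have hpow : ∀ γ : Fin (n + 1) → Lattice d,
      Real.exp s ^ endHeight hd γ = Real.exp (s * endHeight hd γ) := by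
    intro γ; rw [mul_comm, Real.exp_nat_mul]
  have hmain := bridgeCount_mul_le
    (E := {γ | v * n ≤ (endHeight hd γ : ℝ) ∧ 2 / 5 * v * n ≤ longHeight R (profile hd γ)})
    (Q := {γ | 3 / 2 * v * n ≤ (endHeight hd γ : ℝ)})
    -- With `t = exp s`, a long zigzag of height `r` contributes `f r * t ^ (2 * r) = exp (3 / 2 * s
    -- * r)`. In units of `s * v * n` the exponents are `1 + 3/2 * 2/5 = 8/5` on `E` against `3/2 +
    -- 1/20` off `Q`; the gap `1/20` is the decay rate.
    (a := Real.exp (s * (v * n)) * Real.exp (3 / 2 * s * (2 / 5 * v * n)))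
    (A := Real.exp (s * (3 / 2 * v * n)) * Real.exp (s * v / 20 * n))
    (B := Real.exp (s * n) * Real.exp (s * v / 20 * n))
    (sum_zigzags_le_sum_renewals (hd := hd) (n := n) (Real.exp_pos s).le hf0)
    (fun γ => mul_nonneg (by positivity) (Finset.prod_nonneg fun z _ => by
      have := hf0 (zigzagHeight (profile hd γ) z); positivity))
    ?_ (by positivity) ?_ ?_
  · have e1 : Real.exp (s * (v * n)) * Real.exp (3 / 2 * s * (2 / 5 * v * n)) =
        Real.exp (8 / 5 * (s * v * n)) := by rw [← Real.exp_add]; congr 1; ring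
    rw [e1] at hmain
    have e2 : Real.exp (s * (3 / 2 * v * n)) * Real.exp (s * v / 20 * n) =
        Real.exp (-(s * v / 20 * n)) * Real.exp (8 / 5 * (s * v * n)) := by
      rw [← Real.exp_add, ← Real.exp_add]; congr 1; ring
    have e3 : Real.exp (-(c * n)) * (Real.exp (s * n) * Real.exp (s * v / 20 * n)) ≤
        Real.exp (-(3 * s * n)) * Real.exp (8 / 5 * (s * v * n)) := by
      rw [← Real.exp_add, ← Real.exp_add, ← Real.exp_add]
      refine Real.exp_le_exp.2 ?_
      have h1 : 0 < s * v * n := by positivity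
      have h2 : c * n = 4 * s * n := by rw [hs]; ring
      nlinarith
    have e4 := mul_le_mul_of_nonneg_right hn
      (show 0 ≤ Real.exp (s * n) * Real.exp (s * v / 20 * n) by positivity)
    have e5 := mul_le_mul_of_nonneg_left e3 (card_bridges_pos (hd := hd) n).le
    refine le_of_mul_le_mul_right ?_ (Real.exp_pos (8 / 5 * (s * v * n)))
    rw [e2] at hmain
    linarith
  · rintro γ - ⟨hγ1, hγ2⟩
    rw [hpow]
    refine mul_le_mul (Real.exp_le_exp.2 (mul_le_mul_of_nonneg_left hγ1 hs0.le)) ?_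
      (by positivity) (by positivity)
    refine (Real.exp_le_exp.2 (mul_le_mul_of_nonneg_left hγ2 (by positivity))).trans ?_
    rw [longHeight, Finset.mul_sum, Real.exp_sum]
    refine Finset.prod_le_prod (fun _ _ => by positivity) fun z _ => ?_
    simp only [hf]
    split_ifs
    · have : Real.exp (-(s / 2)) ^ zigzagHeight (profile hd γ) z *
          Real.exp s ^ (2 * zigzagHeight (profile hd γ) z) =
          Real.exp (3 / 2 * s * zigzagHeight (profile hd γ) z) := by
        rw [← Real.exp_nat_mul, ← Real.exp_nat_mul, ← Real.exp_add]
        congr 1; push_cast; ring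
      rw [this]; linarith
    · simp
  · intro γ _ hγ
    rw [Set.mem_ofPred_eq, not_le] at hγ
    rw [hpow]
    exact mul_le_mul (Real.exp_le_exp.2 (mul_le_mul_of_nonneg_left hγ.le hs0.le)) (hren γ)
      (pow_nonneg (Finset.prod_nonneg fun r _ => by linarith [hf0 r]) _) (by positivity)
  · intro γ hγ
    rw [hpow]
    refine mul_le_mul (Real.exp_le_exp.2 (mul_le_mul_of_nonneg_left ?_ hs0.le)) (hren γ)
      (pow_nonneg (Finset.prod_nonneg fun r _ => by linarith [hf0 r]) _) (by positivity)
    exact_mod_cast endHeight_le hγ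

/-- If a small positive density of renewals is rare, then so is a positive density of levels
covered by zigzags of bounded height. -/
theorem isRare_shortHeight {v : ℝ} (hv : 0 < v) {R : ℕ} (hR : 1 ≤ R)
    (h : IsRare hd fun n =>
      {γ | v / (10 * (R : ℝ) ^ 2) * n ≤ ((renewals (profile hd γ)).card : ℝ)}) :
    IsRare hd fun n => {γ | 2 / 5 * v * n ≤ shortHeight R (profile hd γ)} := by
  obtain ⟨c, hc, h⟩ := h
  have hR0 : (0 : ℝ) < R := by exact_mod_cast hR
  -- The bound `p ≤ 1` gives `exp (p / 2) ≤ 1 + p`; the bound `p * R ≤ c / 4` keeps the weight on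
  -- `Q` below `exp (c / 2 * n)`.
  set p : ℝ := min 1 (c / (4 * R)) with hp
  have hp0 : 0 < p := lt_min one_pos (by positivity)
  have hp1 : p ≤ 1 := min_le_left _ _
  have hpR : p * R ≤ c / 4 := by
    have := mul_le_mul_of_nonneg_right (min_le_right 1 (c / (4 * R))) hR0.le
    rw [← hp] at this
    refine this.trans_eq ?_
    field_simp
  refine .of_le_exp_add_exp (a := p * v / (10 * R)) (b := c / 2) (by positivity)
    (by positivity) ?_
  filter_upwards [h, eventually_ge_atTop 1] with n hn hn1
  have hn1' : (1 : ℝ) ≤ n := by exact_mod_cast hn1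
  set f : ℕ → ℝ := fun r => if r ≤ R then p else 0 with hf
  have hf0 : ∀ r, 0 ≤ f r := fun r => by simp only [hf]; split_ifs <;> positivity
  have hκ : ∑ r ∈ Finset.Icc 1 n, f r ≤ p * R := by
    rw [hf, ← Finset.sum_filter, Finset.sum_const, nsmul_eq_mul, mul_comm]
    refine mul_le_mul_of_nonneg_left ?_ hp0.le
    have h1 : (Finset.Icc 1 n).filter (· ≤ R) ⊆ Finset.Icc 1 R := fun r hr => by
      simp only [Finset.mem_filter, Finset.mem_Icc] at hr ⊢; omega
    have := Finset.card_le_card h1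
    rw [Nat.card_Icc, Nat.add_sub_cancel] at this
    exact_mod_cast this
  have hexp : Real.exp (p / 2) ≤ 1 + p := by
    have h1 := Real.abs_exp_sub_one_le (x := p / 2) (by rw [abs_of_pos (by positivity)]; linarith)
    rw [abs_of_pos (show 0 < p / 2 by positivity)] at h1
    have := le_abs_self (Real.exp (p / 2) - 1)
    linarith
  have hmain := bridgeCount_mul_le
    (E := {γ | 2 / 5 * v * n ≤ shortHeight R (profile hd γ)})
    (Q := {γ | v / (10 * (R : ℝ) ^ 2) * n ≤ ((renewals (profile hd γ)).card : ℝ)})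
    -- A zigzag of height at most `R` has weight at least `exp (p / 2)`, that is `p / (2 * R)` per
    -- level. In units of `p * v * n / R` the exponents are `1/5` on `E` and `1/10` off `Q`.
    (a := Real.exp (p / (2 * R) * (2 / 5 * v * n)))
    (A := Real.exp (p * R * (v / (10 * (R : ℝ) ^ 2) * n)))
    (B := Real.exp (c / 2 * n))
    (sum_zigzags_le_sum_renewals (hd := hd) (n := n) zero_le_one hf0)
    (fun γ => mul_nonneg (by positivity) (Finset.prod_nonneg fun z _ => by
      have := hf0 (zigzagHeight (profile hd γ) z); positivity))
    ?_ (by positivity) ?_ ?_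
  · set x : ℝ := p * v / (10 * R) * n with hx
    have hx0 : 0 < x := by positivity
    have e1 : p / (2 * R) * (2 / 5 * v * n) = 2 * x := by rw [hx]; field_simp; norm_num
    have e2 : p * R * (v / (10 * (R : ℝ) ^ 2) * n) = x := by rw [hx]; field_simp
    rw [e1, e2] at hmain
    have e3 : Real.exp x = Real.exp (-x) * Real.exp (2 * x) := by
      rw [← Real.exp_add]; congr 1; ring
    have e4 : Real.exp (-(c * n)) * Real.exp (c / 2 * n) ≤
        Real.exp (-(c / 2 * n)) * Real.exp (2 * x) := by
      rw [← Real.exp_add, ← Real.exp_add]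
      exact Real.exp_le_exp.2 (by linarith)
    have e5 := mul_le_mul_of_nonneg_right hn (Real.exp_pos (c / 2 * n)).le
    have e6 := mul_le_mul_of_nonneg_left e4 (card_bridges_pos (hd := hd) n).le
    refine le_of_mul_le_mul_right ?_ (Real.exp_pos (2 * x))
    rw [e3] at hmain
    linarith
  · intro γ _ hγ
    rw [one_pow, one_mul]
    refine (Real.exp_le_exp.2 (mul_le_mul_of_nonneg_left hγ (by positivity))).trans ?_
    rw [shortHeight, Finset.mul_sum, Real.exp_sum]
    refine Finset.prod_le_prod (fun _ _ => by positivity) fun z _ => ?_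
    simp only [hf, one_pow, mul_one]
    split_ifs with hz
    · refine le_trans (Real.exp_le_exp.2 ?_) hexp
      have hz' : (zigzagHeight (profile hd γ) z : ℝ) ≤ R := by exact_mod_cast hz
      refine (mul_le_mul_of_nonneg_left hz' (by positivity)).trans_eq ?_
      field_simp
    · simp
  · intro γ _ hγ
    rw [Set.mem_ofPred_eq, not_le] at hγ
    rw [one_pow, one_mul]
    exact (prod_one_add_pow_card_le hf0 hκ _).trans
      (Real.exp_le_exp.2 (mul_le_mul_of_nonneg_left hγ.le (by positivity)))
  · intro γ _
    rw [one_pow, one_mul]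
    refine (prod_one_add_pow_card_le hf0 hκ _).trans (Real.exp_le_exp.2 ?_)
    have h1 : ((renewals (profile hd γ)).card : ℝ) ≤ n + 1 := by exact_mod_cast card_renewals_le
    have h2 : 0 ≤ p * R := by positivity
    nlinarith

theorem card_renewals_le_ncard {n : ℕ} {γ : Fin (n + 1) → Lattice d} (hγ : γ ∈ SAB hd n) :
    (renewals (profile hd γ)).card ≤ (renewalPoints hd γ).ncard := by
  classical
  have hfin : (renewalPoints hd γ).Finite := by
    refine (Set.finite_range γ).subset ?_
    rintro u ⟨i, hi, rfl, -⟩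
    exact ⟨_, rfl⟩
  rw [← Finset.card_image_of_injective _ hγ.2.selfAvoiding.2, ← Set.ncard_coe_finset]
  refine Set.ncard_le_ncard ?_ hfin
  intro u hu
  obtain ⟨i, hi, rfl⟩ := Finset.mem_image.1 (Finset.mem_coe.1 hu)
  exact mem_renewalPoints hγ (mem_renewals.1 hi)

/-- If every positive density of renewals is rare, then height `v` is rare as soon as height
`3v/2` is. -/
theorem isRare_endHeight {v : ℝ} (hv : 0 < v)
    (hren : ∀ δ : ℝ, 0 < δ → IsRare hd fun n =>
      {γ | δ * n ≤ ((renewals (profile hd γ)).card : ℝ)})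
    (h : IsRare hd fun n => {γ | 3 / 2 * v * n ≤ (endHeight hd γ : ℝ)}) :
    IsRare hd fun n => {γ | v * n ≤ (endHeight hd γ : ℝ)} := by
  obtain ⟨R, hR, hlong⟩ := exists_isRare_longHeight hv h
  have hR0 : (0 : ℝ) < R := by exact_mod_cast hR
  have hshort := isRare_shortHeight (hd := hd) hv hR (hren _ (by positivity))
  refine ((hlong.union hshort).union (hren (v / 10) (by positivity))).mono
    (.of_forall fun n γ hγ hE => ?_)
  simp only [Set.mem_union, Set.mem_ofPred_eq] at hE ⊢
  have h1 := endHeight_le_renewals_add hγ R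
  by_contra hc
  -- The three shares add up to `2/5 + 2/5 + 1/10 < 1`, too little to cover height `v * n`.
  push Not at hc
  have h2 := hc.1.1 hE
  have h3 : 0 ≤ v * n := by positivity
  linarith [hc.1.2, hc.2]

theorem isRare_endHeight_of_one_lt {v : ℝ} (hv : 1 < v) :
    IsRare hd fun n => {γ | v * n ≤ (endHeight hd γ : ℝ)} := by
  refine ⟨1, one_pos, ?_⟩
  filter_upwards [eventually_ge_atTop 1] with n hn
  have hn' : (1 : ℝ) ≤ n := by exact_mod_cast hn
  have h0 : bridgeCount hd n {γ | v * n ≤ (endHeight hd γ : ℝ)} = 0 := by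
    rw [bridgeCount, Nat.cast_eq_zero, Finset.card_eq_zero, Finset.filter_eq_empty_iff]
    intro γ hγ hE
    have h1 : (endHeight hd γ : ℝ) ≤ n := by exact_mod_cast endHeight_le (mem_bridges.1 hγ)
    have h2 : v * n ≤ (endHeight hd γ : ℝ) := hE
    nlinarith
  rw [h0]
  positivity

theorem isRare_endHeight_of_isRare_renewals
    (hren : ∀ δ : ℝ, 0 < δ → IsRare hd fun n =>
      {γ | δ * n ≤ ((renewals (profile hd γ)).card : ℝ)}) {v : ℝ} (hv : 0 < v) :
    IsRare hd fun n => {γ | v * n ≤ (endHeight hd γ : ℝ)} := by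
  -- `k` is a number of factors `3/2` that lifts `u` above one, where the event is empty for `n ≥
  -- 1`.
  have key : ∀ (k : ℕ) (u : ℝ), 0 < u → 1 < (3 / 2) ^ k * u →
      IsRare hd fun n => {γ | u * n ≤ (endHeight hd γ : ℝ)} := by
    intro k
    induction k with
    | zero => intro u _ h1; exact isRare_endHeight_of_one_lt (by simpa using h1)
    | succ k ih =>
      intro u hu h1
      exact isRare_endHeight hu hren
        (ih (3 / 2 * u) (by positivity) (by rwa [pow_succ, mul_assoc] at h1))
  obtain ⟨k, hk⟩ := pow_unbounded_of_one_lt (1 / v) (show (1 : ℝ) < 3 / 2 by norm_num)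
  exact key k v hv (by rwa [div_lt_iff₀ hv] at hk)

end Estimates
end SAW

open SAW
theorem theorem2p3 (d : ℕ) (hd : 2 ≤ d)
    (ballistic : ∃ v : ℝ, 0 < v ∧
      limsup (fun n : ℕ =>
        ENNReal.log (bridgeLaw hd n {γ | v * n ≤ (yCoord hd (γ (Fin.last n)) : ℝ)}) / (n : EReal))
        atTop = 0) :
    ∃ δ : ℝ, 0 < δ ∧
      limsup (fun n : ℕ =>
        ENNReal.log (bridgeLaw hd n {γ | δ * n ≤ ((renewalPoints hd γ).ncard : ℝ)}) / (n : EReal))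
        atTop = 0 := by
  obtain ⟨v, hv, hlim⟩ := ballistic
  by_contra! hc
  have hren : ∀ δ : ℝ, 0 < δ → IsRare hd fun n =>
      {γ | δ * n ≤ ((renewals (profile hd γ)).card : ℝ)} := fun δ hδ =>
    ((isRare_iff _).2 (hc δ hδ)).mono (.of_forall fun n γ hγ h =>
      le_trans (Set.mem_ofPred_eq ▸ h) (Nat.cast_le.2 (card_renewals_le_ncard hγ)))
  refine (isRare_iff fun n => {γ | v * n ≤ (yCoord hd (γ (Fin.last n)) : ℝ)}).1
    ((isRare_endHeight_of_isRare_renewals hren hv).mono (.of_forall fun n γ hγ h => ?_)) hlim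
  have h1 : ((endHeight hd γ : ℤ) : ℝ) = (yCoord hd (γ (Fin.last n)) : ℝ) :=
    congrArg _ (coe_endHeight hγ)
  rw [Int.cast_natCast] at h1
  rw [Set.mem_ofPred_eq, h1]
  exact h
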